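/- Let $\alpha\in[-1,1]\setminus\{0\}$, let $j_*\ge 1$ and $k\ge 2j_*-1$ be integers, and let $p:\mathbb R\to\mathbb R$ be an even $C^2$ function, strictly monotone on $[0,\infty)$, such that $|p(\xi)|\eqsim|\xi|^{\alpha}$, $|p'(\xi)|\eqsim|\xi|^{\alpha-1}$ and $|p''(\xi)|\lesssim|\xi|^{\alpha-2}$ for $|\xi|\gg1$, and such that near the origin $p(\xi)=p(0)+\xi^{2j_*}\tilde p(\xi)$ with $\tilde p$ locally Lipschitz and $\tilde p(0)\ne0$. Put $$m(a,b)=\frac{a+b}{2\,[\,p(a)a+p(b)b-p(a+b)(a+b)\,]},\qquad N(\xi,\eta,\sigma)=\frac{m(\xi-\eta,\eta)}{\xi}-\frac{m(\xi-\eta,\sigma)}{\xi-\eta+\sigma}.$$ Let $\mathcal A_{2,+}^c$ be the set of $(\xi,\eta,\sigma)\in[1,\infty)^3$ such that $|z_1-z_2|+|z_2-z_3|\le\frac1{10}|z_2|$ for every rearrangement $(z_1,z_2,z_3)$ of $(\xi,\eta,\sigma)$. Let $\mathcal B$ be the set of $(\xi,\eta,\sigma)\in\mathbb R^3$ with $\xi,\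 \xi-\eta+\sigma,\ \sigma\ge1$ and $$|\sigma-\eta|+|\xi-\sigma|\le\tfrac1{10}\xi,\quad |\xi-\eta|+|\sigma-\xi|\le\tfrac1{10}\sigma,\quad |\eta-\sigma|+|\xi-\eta|\le\tfrac1{10}(\xi-\eta+\sigma).$$ For real-valued $u$ with Fourier transform $\hat u(\xi)=\int u(x)e^{-ix\xi}\,dx$, the main commutator is $$[\mathcal A_{2,+}^c\cap\mathcal B](\tilde F_{1,0}+\tilde G_{1,0})=-\mathrm i\int_{\mathcal A_{2,+}^c\cap\mathcal B}N(\xi,\eta,\sigma)\,(\xi-\eta)\,\sigma^k\xi^{k+1}\,\hat u(\xi-\eta)\hat u(\eta-\sigma)\hat u(\sigma)\overline{\hat u(\xi)}\,d\xi\,d\eta\,d\sigma .$$ Then there is a constant $C$, depending only on $p$, $\alpha$, $j_*$ and $k$, such that the following hold. (i) The symbol gains two derivatives: for all $(\xi,\eta,\sigma)\in\mathcal A_{2,+}^c\cap\mathcal B$ (a quotient with zero denominator being read as $0$, which matters only on the null set $\xi=\eta$), $$|N(\xi,\eta,\sigma)|\le C\,\Big|\frac{m(\xi-\eta,\eta)}{\xi}\Big|\,\Big|\frac{m(\xi-\eta,\sigma)}{\xi-\eta+\sigma}\Big|\;|\xi-\eta|\,|\sigma-\eta|\,\eta^{\alpha-1}.$$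 (ii) For every real-valued $u\in H^2(\mathbb R)\cap H^k(\mathbb R)$ the integral defining the main commutator converges absolutely, and $$\big|[\mathcal A_{2,+}^c\cap\mathcal B](\tilde F_{1,0}+\tilde G_{1,0})\big|\le C\,\|u\|_{H^1}\|u\|_{H^2}\|u\|_{H^k}^2 .$$ -/

import Mathlib

open MeasureTheory Filter Topology Asymptotics Set
open scoped FourierTransform

noncomputable section

namespace Whitham

/-- The standing assumptions on the dispersive symbol `p` of a Whitham-type equation of order `α`,
with an extremum of order `2j` at the origin.

Far field: `|p| ≂ |ξ|^α` and `|p'| ≂ |ξ|^(α-1)` as `|ξ| → ∞`. Of the second derivative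
only the upper bound `|p''| ≲ |ξ|^(α-2)` is asked for: it is weaker than `|p''| ≂ |ξ|^(α-2)`, and
for `α = 1` the two-sided version would contradict `|p'| ≂ 1`. -/
structure IsSymbol (α : ℝ) (j : ℕ) (p : ℝ → ℝ) : Prop where
  order_mem : α ∈ Icc (-1 : ℝ) 1
  order_ne_zero : α ≠ 0
  one_le : 1 ≤ j
  contDiff : ContDiff ℝ 2 p
  even : ∀ ξ, p (-ξ) = p ξ
  strictMonotone : StrictMonoOn p (Ici 0) ∨ StrictAntiOn p (Ici 0)
  far_zero : p =Θ[cocompact ℝ] fun ξ => |ξ| ^ α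
  far_one : deriv p =Θ[cocompact ℝ] fun ξ => |ξ| ^ (α - 1)
  far_two : iteratedDeriv 2 p =O[cocompact ℝ] fun ξ => |ξ| ^ (α - 2)
  near_zero : ∃ q : ℝ → ℝ, ∃ δ > 0, LocallyLipschitzOn (Ioo (-δ) δ) q ∧ q 0 ≠ 0 ∧
    ∀ ξ ∈ Ioo (-δ) δ, p ξ = p 0 + ξ ^ (2 * j) * q ξ

/-- The normal form multiplier `m(a,b) = (a+b) / (2 [p(a) a + p(b) b - p(a+b) (a+b)])`. -/
def mult (p : ℝ → ℝ) (a b : ℝ) : ℝ :=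
  (a + b) / (2 * (p a * a + p b * b - p (a + b) * (a + b)))

/-- The Fourier transform `û(ξ) = ∫ u(x) e^{-ixξ} dx` of a real-valued `u ∈ L²(ℝ)`: Mathlib's
`L²` transform has the kernel `e^{-2πixξ}`, hence the rescaling. -/
def uhat (u : Lp ℝ 2 (volume : Measure ℝ)) (ξ : ℝ) : ℂ :=
  (𝓕 (Complex.ofRealCLM.compLp u : Lp ℂ 2 (volume : Measure ℝ)) : Lp ℂ 2 (volume : Measure ℝ))
    (ξ / (2 * Real.pi))

/-- `u ∈ H^s(ℝ)`, for `u ∈ L²(ℝ)`. -/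
def MemH (s : ℕ) (u : Lp ℝ 2 (volume : Measure ℝ)) : Prop :=
  Integrable (fun ξ : ℝ => (1 + ξ ^ 2) ^ s * ‖uhat u ξ‖ ^ 2)

/-- The norm of `H^s(ℝ)`, normalised so that it is the `L²` norm for `s = 0`. -/
def normH (s : ℕ) (u : Lp ℝ 2 (volume : Measure ℝ)) : ℝ :=
  Real.sqrt ((2 * Real.pi)⁻¹ * ∫ ξ : ℝ, (1 + ξ ^ 2) ^ s * ‖uhat u ξ‖ ^ 2)

/-! Regions of the frequency space, whose points are `(ξ, η, σ)`. -/

/-- Low frequencies. -/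
def regA1 : Set (ℝ × ℝ × ℝ) := {(ξ, η, σ) | min |ξ| (min |η| |σ|) < 1}

/-- High frequencies, away from the diagonal; `(z₁, z₂, z₃)` runs through the rearrangements of
`(ξ, η, σ)`. -/
def regA2 : Set (ℝ × ℝ × ℝ) :=
  {(ξ, η, σ) | (ξ, η, σ) ∈ regA1ᶜ ∧ ∃ e : Equiv.Perm (Fin 3),
    let z : Fin 3 → ℝ := fun i => ![ξ, η, σ] (e i)
    1 / 10 * |z 1| < |z 0 - z 1| + |z 1 - z 2|}

/-- The positive part of the high, near-diagonal frequencies, `𝒜₂,₊ᶜ`. -/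
def regA2cPos : Set (ℝ × ℝ × ℝ) :=
  {(ξ, η, σ) | (ξ, η, σ) ∈ regA1ᶜ \ regA2 ∧ 1 ≤ ξ ∧ 1 ≤ η ∧ 1 ≤ σ}

def regB1 : Set (ℝ × ℝ × ℝ) := {(ξ, η, σ) | 1 ≤ ξ ∧ 1 ≤ ξ - η + σ ∧ 1 ≤ σ}

def regB2 : Set (ℝ × ℝ × ℝ) :=
  {(ξ, η, σ) | |σ - η| + |ξ - σ| ≤ 1 / 10 * ξ ∧
    |ξ - η| + |σ - ξ| ≤ 1 / 10 * σ ∧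
    |η - σ| + |ξ - η| ≤ 1 / 10 * (ξ - η + σ)}

def regB : Set (ℝ × ℝ × ℝ) := regB1 ∩ regB2

/-- `N(ξ,η,σ) = m(ξ-η,η)/ξ - m(ξ-η,σ)/(ξ-η+σ)`. -/
def commSymbol (p : ℝ → ℝ) (ξ η σ : ℝ) : ℝ :=
  mult p (ξ - η) η / ξ - mult p (ξ - η) σ / (ξ - η + σ)

/-- The density of `dM(û)`: `û(ξ-η) û(η-σ) û(σ) conj(û(ξ))`. -/
def quarticDensity (u : Lp ℝ 2 (volume : Measure ℝ)) (ξ η σ : ℝ) : ℂ :=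
  uhat u (ξ - η) * uhat u (η - σ) * uhat u σ * (starRingEnd ℂ) (uhat u ξ)

/-- The integrand `[m(ξ-η,σ)/(ξ-η+σ) - m(ξ-η,η)/ξ] (ξ-η) σ^k ξ^(k+1)` times the density of
`dM(û)`; the bracket is `-N`. -/
def commIntegrand (p : ℝ → ℝ) (k : ℕ) (u : Lp ℝ 2 (volume : Measure ℝ)) (z : ℝ × ℝ × ℝ) : ℂ :=
  let ξ := z.1
  let η := z.2.1
  let σ := z.2.2
  ((-commSymbol p ξ η σ * (ξ - η) * σ ^ k * ξ ^ (k + 1) : ℝ) : ℂ) * quarticDensity u ξ η σ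

/-- The main commutator `[𝒜₂,₊ᶜ ∩ ℬ](F̃₁,₀ + G̃₁,₀)`. -/
def mainCommutator (p : ℝ → ℝ) (k : ℕ) (u : Lp ℝ 2 (volume : Measure ℝ)) : ℂ :=
  Complex.I * ∫ z in regA2cPos ∩ regB, commIntegrand p k u z

end Whitham

end

/-!
Write `D(a, b) = p(a) a + p(b) b - p(a+b) (a+b)`, so that `m(a, b) / (a + b) = 1 / (2 D(a, b))` and
`N = (D(ξ-η, σ) - D(ξ-η, η)) / (2 D(ξ-η, η) D(ξ-η, σ))`. The numerator is a second difference of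
`x ↦ x p(x)` with increments `ξ - η` and `σ - η` at height `η`, hence
`O(|ξ - η| |σ - η| η ^ (α - 1))`: this is the gain of two derivatives.

For the denominator, let `0 < a ≤ b`. By evenness and monotonicity
`|D(a, b)| ≥ a |p(a + b) - p(a)|`; the increment contains a dyadic one, `|p(2x) - p(x)| ≳ x ^ α`,
with `x ≈ b` if `α ≥ 0` and `x ≈ max(a, 1/2)` if `α < 0`. As `α ≥ -1`, in both cases
`√(1 + a) |D(a, b)| ≳ a b ^ (α / 2)`. Near the diagonal this yields
`|N| |ξ - η| ξ ≲ (1 + |ξ - η|) |η - σ| ≤ 2 ⟨ξ - η⟩ ⟨η - σ⟩`.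

The commutator integrand is therefore dominated by `w(ξ-η) w(η-σ) h(σ) h(ξ)` with `w = ⟨x⟩ |û|` and
`h = ⟨x⟩^k |û|`. Its integral is at most `‖w‖₁² ‖h‖₂²`, and Carlson's inequality
`‖w‖₁² ≤ 2π ‖w‖₂ ‖x w‖₂` gives `‖w‖₁² ≲ ‖u‖_{H¹} ‖u‖_{H²}`.
-/

open scoped ENNReal NNReal

namespace Whitham

section Growth

variable {E : Type*} [NormedAddCommGroup E]

lemma rpow_le_two_rpow_abs_mul {x y : ℝ} (s : ℝ) (hx : 0 < x) (hyx : y ≤ 2 * x)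
    (hxy : x ≤ 2 * y) : y ^ s ≤ 2 ^ |s| * x ^ s := by
  have hy : 0 < y := by linarith
  rw [← div_le_iff₀ (by positivity), ← Real.div_rpow hy.le hx.le]
  rcases le_total 0 s with hs | hs
  · rw [abs_of_nonneg hs]
    exact Real.rpow_le_rpow (by positivity) ((div_le_iff₀ hx).2 hyx) hs
  · rw [abs_of_nonpos hs, ← inv_div, Real.inv_rpow (by positivity), ← Real.rpow_neg (by positivity)]
    exact Real.rpow_le_rpow (by positivity) ((div_le_iff₀ hy).2 hxy) (neg_nonneg.2 hs)

lemma eventuallyEq_abs_rpow_atTop (s : ℝ) :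
    (fun x : ℝ => |x| ^ s) =ᶠ[atTop] fun x => x ^ s := by
  filter_upwards [eventually_ge_atTop 0] with x hx
  rw [abs_of_nonneg hx]

lemma exists_norm_le_mul_of_isBigO_atTop {f : ℝ → E} {g : ℝ → ℝ} {r : ℝ}
    (hf : ContinuousOn f (Ici r)) (hg : ContinuousOn g (Ici r)) (hpos : ∀ x, r ≤ x → 0 < g x)
    (hfg : f =O[atTop] g) : ∃ K > 0, ∀ x, r ≤ x → ‖f x‖ ≤ K * g x := by
  obtain ⟨K, hK, hbound⟩ := hfg.exists_pos
  obtain ⟨R, hR⟩ := eventually_atTop.1 hbound.bound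
  have hquot : ContinuousOn (fun x => ‖f x‖ / g x) (Icc r R) :=
    (hf.norm.div hg fun x hx => (hpos x hx).ne').mono Icc_subset_Ici_self
  obtain ⟨M, hM⟩ := isCompact_Icc.bddAbove_image hquot
  refine ⟨max M K, lt_max_of_lt_right hK, fun x hx => ?_⟩
  have hgx := hpos x hx
  rcases le_total x R with hxR | hxR
  · have hle : ‖f x‖ / g x ≤ M := hM (mem_image_of_mem _ ⟨hx, hxR⟩)
    calc ‖f x‖ ≤ M * g x := (div_le_iff₀ hgx).1 hle
      _ ≤ max M K * g x := by gcongr; exact le_max_left M K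
  · calc ‖f x‖ ≤ K * ‖g x‖ := hR x hxR
      _ = K * g x := by rw [Real.norm_of_nonneg hgx.le]
      _ ≤ max M K * g x := by gcongr; exact le_max_right M K

lemma norm_second_difference_le [NormedSpace ℝ E] {g g' g'' : ℝ → E} {s : Set ℝ} {M a x y : ℝ}
    (hs : Convex ℝ s) (hg : ∀ z ∈ s, HasDerivAt g (g' z) z)
    (hg' : ∀ z ∈ s, HasDerivAt g' (g'' z) z) (hM : ∀ z ∈ s, ‖g'' z‖ ≤ M)
    (hx : x ∈ s) (hy : y ∈ s) (hxa : x + a ∈ s) (hya : y + a ∈ s) :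
    ‖(g (y + a) - g y) - (g (x + a) - g x)‖ ≤ M * |a| * |y - x| := by
  have hadd : Convex ℝ {z | z + a ∈ s} := hs.translate_preimage_left a
  refine (hs.inter hadd).norm_image_sub_le_of_norm_hasDerivWithin_le
    (f := fun z => g (z + a) - g z) (f' := fun z => g' (z + a) - g' z)
    (fun z hz => (((hg _ hz.2).comp_add_const z a).fun_sub (hg z hz.1)).hasDerivWithinAt)
    (fun z hz => ?_) ⟨hx, hxa⟩ ⟨hy, hya⟩
  simpa using hs.norm_image_sub_le_of_norm_hasDerivWithin_le
    (fun w hw => (hg' w hw).hasDerivWithinAt) hM hz.1 hz.2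

lemma rpow_isBigO_dyadic_increment {f : ℝ → ℝ} {α : ℝ} (hf : Differentiable ℝ f)
    (hderiv : (fun x => x ^ (α - 1)) =O[atTop] deriv f) :
    (fun x => x ^ α) =O[atTop] fun x => f (2 * x) - f x := by
  obtain ⟨K, hbound⟩ := hderiv.bound
  obtain ⟨R, hR⟩ := eventually_atTop.1 hbound
  refine IsBigO.of_bound (2 ^ |α - 1| * K) ?_
  filter_upwards [eventually_ge_atTop R, eventually_gt_atTop 0] with x hxR hx
  obtain ⟨y, ⟨hxy, hyx⟩, hslope⟩ := exists_deriv_eq_slope f (by linarith : x < 2 * x)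
    hf.continuous.continuousOn hf.differentiableOn
  have hincr : f (2 * x) - f x = deriv f y * x := by
    rw [hslope]
    field
  have hy : 0 < y := hx.trans hxy
  have hfar : y ^ (α - 1) ≤ K * ‖deriv f y‖ := by
    simpa [abs_of_pos (Real.rpow_pos_of_pos hy _)] using hR y (hxR.trans hxy.le)
  calc ‖x ^ α‖ = x ^ (α - 1) * x := by
        rw [Real.norm_of_nonneg (by positivity), Real.rpow_sub_one hx.ne', div_mul_cancel₀ _ hx.ne']
    _ ≤ 2 ^ |α - 1| * y ^ (α - 1) * x := by
        gcongr
        exact rpow_le_two_rpow_abs_mul _ hy (by linarith) (by linarith)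
    _ ≤ 2 ^ |α - 1| * (K * ‖deriv f y‖) * x := by gcongr
    _ = 2 ^ |α - 1| * K * ‖f (2 * x) - f x‖ := by
        rw [hincr, norm_mul, Real.norm_of_nonneg hx.le]
        ring

lemma exists_rpow_le_dyadic_increment {f : ℝ → ℝ} {α r : ℝ} (hr : 0 < r)
    (hf : Differentiable ℝ f) (hmono : StrictMonoOn f (Ici 0))
    (hderiv : (fun x => x ^ (α - 1)) =O[atTop] deriv f) :
    ∃ c > 0, ∀ x, r ≤ x → c * x ^ α ≤ f (2 * x) - f x := by
  have hcont : Continuous f := hf.continuous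
  obtain ⟨K, hK, hle⟩ := exists_norm_le_mul_of_isBigO_atTop (r := r)
    (f := fun x : ℝ => x ^ α) (g := fun x => f (2 * x) - f x)
    (continuousOn_id.rpow_const fun x hx => Or.inl (hr.trans_le hx).ne')
    (by fun_prop)
    (fun x hx => sub_pos.2 <| hmono (mem_Ici.2 (by linarith)) (mem_Ici.2 (by linarith))
      (by linarith))
    (rpow_isBigO_dyadic_increment hf hderiv)
  refine ⟨K⁻¹, by positivity, fun x hx => ?_⟩
  rw [inv_mul_le_iff₀ hK]
  exact (le_abs_self _).trans (hle x hx)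

lemma exists_dyadic_scale {α a b : ℝ} (hα : -1 ≤ α) (ha : 0 < a) (hab : a ≤ b) (hb : 1 ≤ b) :
    ∃ x, 1 / 2 ≤ x ∧ a ≤ x ∧ 2 * x ≤ a + b ∧ 2 ^ (-|α|) * b ^ (α / 2) ≤ √(1 + a) * x ^ α := by
  have hb0 : 0 < b := by linarith
  rcases le_total 0 α with hα0 | hα0
  · refine ⟨(a + b) / 2, by linarith, by linarith, by linarith, ?_⟩
    have hsqrt : 1 ≤ √(1 + a) := Real.one_le_sqrt.2 (by linarith)
    calc (2 : ℝ) ^ (-|α|) * b ^ (α / 2) ≤ 2 ^ (-|α|) * b ^ α := by gcongr; linarith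
      _ ≤ ((a + b) / 2) ^ α := by
        rw [Real.rpow_neg (by norm_num), inv_mul_le_iff₀ (by positivity)]
        exact rpow_le_two_rpow_abs_mul _ (by linarith) (by linarith) (by linarith)
      _ ≤ √(1 + a) * ((a + b) / 2) ^ α := le_mul_of_one_le_left (by positivity) hsqrt
  · have hmax : max a (1 / 2) ≤ 1 + a := max_le (by linarith) (by linarith)
    refine ⟨max a (1 / 2), le_max_right _ _, le_max_left _ _, ?_, ?_⟩
    · rw [mul_max_of_nonneg _ _ zero_le_two]
      exact max_le (by linarith) (by linarith)
    calc (2 : ℝ) ^ (-|α|) * b ^ (α / 2) ≤ 2 ^ (α / 2) * b ^ (α / 2) := by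
          gcongr
          · norm_num
          · rw [abs_of_nonpos hα0]
            linarith
      _ = (2 * b) ^ (α / 2) := (Real.mul_rpow zero_le_two hb0.le).symm
      _ ≤ (1 + a) ^ (α / 2) :=
          Real.rpow_le_rpow_of_nonpos (by linarith) (by linarith) (by linarith)
      _ ≤ (1 + a) ^ (1 / 2 + α) :=
          Real.rpow_le_rpow_of_exponent_le (by linarith) (by linarith)
      _ = √(1 + a) * (1 + a) ^ α := by rw [Real.rpow_add (by linarith), Real.sqrt_eq_rpow]
      _ ≤ √(1 + a) * max a (1 / 2) ^ α :=
          mul_le_mul_of_nonneg_left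
            (Real.rpow_le_rpow_of_nonpos (lt_max_of_lt_left ha) hmax hα0) (Real.sqrt_nonneg _)

lemma exists_rpow_half_le_increment {f : ℝ → ℝ} {α : ℝ} (hα : -1 ≤ α)
    (hf : Differentiable ℝ f) (hmono : StrictMonoOn f (Ici 0))
    (hderiv : (fun x => x ^ (α - 1)) =O[atTop] deriv f) :
    ∃ c > 0, ∀ a b : ℝ, 0 < a → a ≤ b → 1 ≤ b →
      c * b ^ (α / 2) ≤ √(1 + a) * (f (a + b) - f a) := by
  obtain ⟨c, hc, hdyadic⟩ := exists_rpow_le_dyadic_increment (r := 1 / 2) (by norm_num) hf hmono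
    hderiv
  refine ⟨c * 2 ^ (-|α|), by positivity, fun a b ha hab hb => ?_⟩
  obtain ⟨x, hx, hax, hxab, hle⟩ := exists_dyadic_scale hα ha hab hb
  have hincr : c * x ^ α ≤ f (a + b) - f a := by
    have hleft := hmono.monotoneOn (mem_Ici.2 ha.le) (mem_Ici.2 (by linarith)) hax
    have hright := hmono.monotoneOn (mem_Ici.2 (by linarith)) (mem_Ici.2 (by linarith)) hxab
    linarith [hdyadic x hx]
  calc c * 2 ^ (-|α|) * b ^ (α / 2) = c * (2 ^ (-|α|) * b ^ (α / 2)) := by ring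
    _ ≤ c * (√(1 + a) * x ^ α) := by gcongr
    _ = √(1 + a) * (c * x ^ α) := by ring
    _ ≤ √(1 + a) * (f (a + b) - f a) := by gcongr

end Growth

section Resonance

variable {p : ℝ → ℝ} {α : ℝ}

/-- The resonance function `p(a) a + p(b) b - p(a+b) (a+b)`, whose reciprocal is
`2 m(a,b) / (a+b)`. -/
def resonance (p : ℝ → ℝ) (a b : ℝ) : ℝ := p a * a + p b * b - p (a + b) * (a + b)

lemma mult_div_add (p : ℝ → ℝ) {a b : ℝ} (h : a + b ≠ 0) :
    mult p a b / (a + b) = (2 * resonance p a b)⁻¹ := by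
  rw [mult, resonance, div_right_comm, div_self h, one_div]

@[simp]
lemma resonance_zero_left (p : ℝ → ℝ) (b : ℝ) : resonance p 0 b = 0 := by
  simp [resonance]

lemma resonance_neg_left (heven : ∀ x, p (-x) = p x) (a b : ℝ) :
    resonance p (-a) b = -resonance p a (b - a) := by
  simp only [resonance, heven, add_sub_cancel, neg_add_eq_sub]
  ring

lemma resonance_neg_symbol (p : ℝ → ℝ) (a b : ℝ) :
    resonance (fun x => -p x) a b = -resonance p a b := by
  simp only [resonance]
  ring

lemma mul_sub_le_abs_resonance (hmono : MonotoneOn p (Ici 0)) {a b : ℝ} (ha : 0 ≤ a)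
    (hb : 0 ≤ b) : a * (p (a + b) - p a) ≤ |resonance p a b| := by
  have hincr : 0 ≤ b * (p (a + b) - p b) :=
    mul_nonneg hb (sub_nonneg.2 (hmono hb (add_nonneg ha hb) (le_add_of_nonneg_left ha)))
  calc a * (p (a + b) - p a) ≤ a * (p (a + b) - p a) + b * (p (a + b) - p b) :=
        le_add_of_nonneg_right hincr
    _ = -resonance p a b := by rw [resonance]; ring
    _ ≤ |resonance p a b| := neg_le_abs _

lemma exists_le_sqrt_mul_abs_resonance_of_pos (hα : -1 ≤ α) (hp : Differentiable ℝ p)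
    (hmono : StrictMonoOn p (Ici 0) ∨ StrictAntiOn p (Ici 0))
    (hderiv : (fun x => x ^ (α - 1)) =O[atTop] deriv p) :
    ∃ c > 0, ∀ a b : ℝ, 0 < a → a ≤ b → 1 ≤ b →
      c * (a * b ^ (α / 2)) ≤ √(1 + a) * |resonance p a b| := by
  wlog hincr : StrictMonoOn p (Ici 0) generalizing p
  · have hneg : StrictMonoOn (fun x => -p x) (Ici 0) := (hmono.resolve_left hincr).neg
    simpa only [resonance_neg_symbol, abs_neg] using
      this hp.fun_neg (Or.inl hneg) (by simpa only [deriv.fun_neg', isBigO_neg_right]) hneg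
  obtain ⟨c, hc, hle⟩ := exists_rpow_half_le_increment hα hp hincr hderiv
  refine ⟨c, hc, fun a b ha hab hb => ?_⟩
  calc c * (a * b ^ (α / 2)) = a * (c * b ^ (α / 2)) := by ring
    _ ≤ a * (√(1 + a) * (p (a + b) - p a)) :=
        mul_le_mul_of_nonneg_left (hle a b ha hab hb) ha.le
    _ = √(1 + a) * (a * (p (a + b) - p a)) := by ring
    _ ≤ √(1 + a) * |resonance p a b| := by
      gcongr
      exact mul_sub_le_abs_resonance hincr.monotoneOn ha.le (by linarith)

lemma exists_le_sqrt_mul_abs_resonance (hα : -1 ≤ α) (hp : Differentiable ℝ p)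
    (heven : ∀ x, p (-x) = p x) (hmono : StrictMonoOn p (Ici 0) ∨ StrictAntiOn p (Ici 0))
    (hderiv : (fun x => x ^ (α - 1)) =O[atTop] deriv p) :
    ∃ c > 0, ∀ a b : ℝ, a ≠ 0 → 2 * |a| ≤ b → 1 ≤ b → 1 ≤ a + b →
      c * (|a| * b ^ (α / 2)) ≤ √(1 + |a|) * |resonance p a b| := by
  obtain ⟨c, hc, hle⟩ := exists_le_sqrt_mul_abs_resonance_of_pos hα hp hmono hderiv
  have hone : (1 : ℝ) ≤ 2 ^ |α / 2| := Real.one_le_rpow one_le_two (abs_nonneg _)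
  refine ⟨c / 2 ^ |α / 2|, by positivity, fun a b ha hab hb hsum => ?_⟩
  rw [div_mul_eq_mul_div, div_le_iff₀ (by positivity)]
  rcases ha.lt_or_gt with hneg | hpos
  · obtain ⟨a, rfl⟩ : ∃ a', a = -a' := ⟨-a, (neg_neg a).symm⟩
    have ha' : 0 < a := neg_neg_iff_pos.1 hneg
    rw [abs_neg, abs_of_pos ha'] at hab ⊢
    rw [resonance_neg_left heven, abs_neg]
    calc c * (a * b ^ (α / 2)) ≤ c * (a * (2 ^ |α / 2| * (b - a) ^ (α / 2))) := by
          gcongr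
          exact rpow_le_two_rpow_abs_mul _ (by linarith) (by linarith) (by linarith)
      _ = c * (a * (b - a) ^ (α / 2)) * 2 ^ |α / 2| := by ring
      _ ≤ √(1 + a) * |resonance p a (b - a)| * 2 ^ |α / 2| :=
          mul_le_mul_of_nonneg_right (hle a (b - a) ha' (by linarith) (by linarith))
            (by positivity)
  · rw [abs_of_pos hpos] at hab ⊢
    exact (hle a b hpos (by linarith) hb).trans (le_mul_of_one_le_right (by positivity) hone)

lemma hasDerivAt_mul_id (hp : ContDiff ℝ 2 p) (x : ℝ) :
    HasDerivAt (fun y => p y * y) (deriv p x * x + p x) x := by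
  simpa using (hp.differentiable two_ne_zero x).hasDerivAt.fun_mul (hasDerivAt_id x)

lemma hasDerivAt_deriv_mul_id (hp : ContDiff ℝ 2 p) (x : ℝ) :
    HasDerivAt (fun y => deriv p y * y + p y) (iteratedDeriv 2 p x * x + 2 * deriv p x) x := by
  have hderiv : Differentiable ℝ (deriv p) :=
    (hp.iterate_deriv' 1 1).differentiable one_ne_zero
  refine (((hderiv x).hasDerivAt.fun_mul (hasDerivAt_id x)).fun_add
    (hp.differentiable two_ne_zero x).hasDerivAt).congr_deriv ?_
  rw [iteratedDeriv_succ, iteratedDeriv_one]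
  simp only [id_eq, mul_one]
  ring

lemma exists_norm_second_deriv_mul_id_le {r : ℝ} (hr : 0 < r) (hp : ContDiff ℝ 2 p)
    (hderiv : deriv p =O[atTop] fun x => x ^ (α - 1))
    (hderiv₂ : iteratedDeriv 2 p =O[atTop] fun x => x ^ (α - 2)) :
    ∃ K > 0, ∀ x, r ≤ x → ‖iteratedDeriv 2 p x * x + 2 * deriv p x‖ ≤ K * x ^ (α - 1) := by
  have hd1 : Continuous (deriv p) := hp.continuous_deriv one_le_two
  refine exists_norm_le_mul_of_isBigO_atTop (by fun_prop)
    (continuousOn_id.rpow_const fun x hx => Or.inl (hr.trans_le hx).ne')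
    (fun x hx => Real.rpow_pos_of_pos (hr.trans_le hx) _) ?_
  have hpow : (fun x : ℝ => x ^ (α - 2) * x) =ᶠ[atTop] fun x => x ^ (α - 1) := by
    filter_upwards [eventually_gt_atTop 0] with x hx
    rw [← Real.rpow_add_one hx.ne']
    congr 1
    ring
  exact ((hderiv₂.mul (isBigO_refl (fun x : ℝ => x) atTop)).trans_eventuallyEq hpow).add
    (hderiv.const_mul_left 2)

lemma exists_abs_resonance_sub_le (hp : ContDiff ℝ 2 p)
    (hderiv : deriv p =O[atTop] fun x => x ^ (α - 1))
    (hderiv₂ : iteratedDeriv 2 p =O[atTop] fun x => x ^ (α - 2)) :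
    ∃ K > 0, ∀ a η σ : ℝ, 1 ≤ η → |a| ≤ η / 4 → |σ - η| ≤ η / 4 →
      |resonance p a σ - resonance p a η| ≤ K * (|a| * |σ - η| * η ^ (α - 1)) := by
  obtain ⟨K, hK, hle⟩ := exists_norm_second_deriv_mul_id_le (r := 1 / 2) (by norm_num) hp hderiv
    hderiv₂
  refine ⟨K * 2 ^ |α - 1|, by positivity, fun a η σ hη ha hσ => ?_⟩
  have hbound : ∀ z ∈ Icc (η / 2) (2 * η),
      ‖iteratedDeriv 2 p z * z + 2 * deriv p z‖ ≤ K * (2 ^ |α - 1| * η ^ (α - 1)) := by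
    intro z ⟨hηz, hzη⟩
    refine (hle z (by linarith)).trans ?_
    gcongr
    exact rpow_le_two_rpow_abs_mul _ (by linarith) hzη (by linarith)
  obtain ⟨ha1, ha2⟩ := abs_le.1 ha
  obtain ⟨hσ1, hσ2⟩ := abs_le.1 hσ
  have hsecond := norm_second_difference_le (convex_Icc (η / 2) (2 * η))
    (fun z _ => hasDerivAt_mul_id hp z) (fun z _ => hasDerivAt_deriv_mul_id hp z) hbound
    (a := a) (x := η) (y := σ) ⟨by linarith, by linarith⟩ ⟨by linarith, by linarith⟩
    ⟨by linarith, by linarith⟩ ⟨by linarith, by linarith⟩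
  calc |resonance p a σ - resonance p a η|
      = ‖(p (σ + a) * (σ + a) - p σ * σ) - (p (η + a) * (η + a) - p η * η)‖ := by
        rw [← norm_neg, Real.norm_eq_abs, resonance, resonance, add_comm a σ, add_comm a η]
        congr 1
        ring
    _ ≤ K * (2 ^ |α - 1| * η ^ (α - 1)) * |a| * |σ - η| := hsecond
    _ = K * 2 ^ |α - 1| * (|a| * |σ - η| * η ^ (α - 1)) := by ring

end Resonance

section Symbol

variable {p : ℝ → ℝ} {α ξ η σ : ℝ}

/-- The points `(ξ, η, σ)` with `|ξ - η| + |η - σ| ≤ η / 10` at which the frequencies `ξ`, `η`, `σ`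
and `ξ - η + σ` are at least `1`: a convenient superset of `𝒜₂,₊ᶜ ∩ ℬ`. -/
def nearDiagonal : Set (ℝ × ℝ × ℝ) :=
  {(ξ, η, σ) | 1 ≤ ξ ∧ 1 ≤ η ∧ 1 ≤ σ ∧ 1 ≤ ξ - η + σ ∧ |ξ - η| + |η - σ| ≤ η / 10}

lemma regA2cPos_inter_regB_subset : regA2cPos ∩ regB ⊆ nearDiagonal := by
  rintro ⟨ξ, η, σ⟩ ⟨⟨⟨hA1, hA2⟩, hξ, hη, hσ⟩, ⟨-, hsum, -⟩, -⟩
  refine ⟨hξ, hη, hσ, hsum, ?_⟩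
  by_contra! hfar
  refine hA2 ⟨hA1, Equiv.refl _, ?_⟩
  simpa [abs_of_pos (zero_lt_one.trans_le hη), div_eq_inv_mul] using hfar

lemma abs_sub_le_of_mem_nearDiagonal (hz : (ξ, η, σ) ∈ nearDiagonal) :
    |ξ - η| ≤ η / 4 ∧ |σ - η| ≤ η / 4 := by
  obtain ⟨-, hη, -, -, hnear⟩ := hz
  rw [abs_sub_comm σ]
  constructor <;> linarith [abs_nonneg (ξ - η), abs_nonneg (η - σ)]

lemma exists_sq_mul_rpow_le_abs_resonance_mul (hα : -1 ≤ α) (hp : Differentiable ℝ p)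
    (heven : ∀ x, p (-x) = p x) (hmono : StrictMonoOn p (Ici 0) ∨ StrictAntiOn p (Ici 0))
    (hderiv : (fun x => x ^ (α - 1)) =O[atTop] deriv p) :
    ∃ c > 0, ∀ ξ η σ : ℝ, ξ ≠ η → (ξ, η, σ) ∈ nearDiagonal →
      resonance p (ξ - η) η * resonance p (ξ - η) σ ≠ 0 ∧
      c * ((ξ - η) ^ 2 * η ^ α) ≤
        (1 + |ξ - η|) * |resonance p (ξ - η) η * resonance p (ξ - η) σ| := by
  obtain ⟨c, hc, hle⟩ := exists_le_sqrt_mul_abs_resonance hα hp heven hmono hderiv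
  refine ⟨c * c / 2 ^ |α / 2|, by positivity, fun ξ η σ hne hz => ?_⟩
  obtain ⟨ha, hησ⟩ := abs_sub_le_of_mem_nearDiagonal hz
  obtain ⟨hξ, hη, hσ, hsum, -⟩ := hz
  obtain ⟨hσ₁, hσ₂⟩ := abs_le.1 hησ
  have hη0 : 0 < η := by linarith
  have ha0 : ξ - η ≠ 0 := sub_ne_zero.2 hne
  have hD₁ := hle (ξ - η) η ha0 (by linarith) hη (by linarith)
  have hD₂ := hle (ξ - η) σ ha0 (by linarith) hσ hsum
  have hpow : η ^ (α / 2) ≤ 2 ^ |α / 2| * σ ^ (α / 2) :=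
    rpow_le_two_rpow_abs_mul _ (by linarith) (by linarith) (by linarith)
  have hprod : c * c / 2 ^ |α / 2| * ((ξ - η) ^ 2 * η ^ α) ≤
      (1 + |ξ - η|) * |resonance p (ξ - η) η * resonance p (ξ - η) σ| := by
    calc c * c / 2 ^ |α / 2| * ((ξ - η) ^ 2 * η ^ α)
        = c * (|ξ - η| * η ^ (α / 2)) * (c * (|ξ - η| * (η ^ (α / 2) / 2 ^ |α / 2|))) := by
          rw [← sq_abs, show η ^ α = η ^ (α / 2) * η ^ (α / 2) by
            rw [← Real.rpow_add hη0, add_halves]]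
          ring
      _ ≤ c * (|ξ - η| * η ^ (α / 2)) * (c * (|ξ - η| * σ ^ (α / 2))) := by
          gcongr
          exact (div_le_iff₀' (by positivity)).2 hpow
      _ ≤ √(1 + |ξ - η|) * |resonance p (ξ - η) η| *
          (√(1 + |ξ - η|) * |resonance p (ξ - η) σ|) := by
          gcongr
      _ = (1 + |ξ - η|) * |resonance p (ξ - η) η * resonance p (ξ - η) σ| := by
          rw [mul_mul_mul_comm, Real.mul_self_sqrt (by positivity), abs_mul]
  have hpos : 0 < c * c / 2 ^ |α / 2| * ((ξ - η) ^ 2 * η ^ α) := by positivity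
  exact ⟨abs_pos.1 (pos_of_mul_pos_right (hpos.trans_le hprod) (by positivity)), hprod⟩

lemma commSymbol_self (p : ℝ → ℝ) (η σ : ℝ) : commSymbol p η η σ = 0 := by
  have hmult (b : ℝ) : mult p 0 b = 0 := by
    rw [mult, ← resonance, resonance_zero_left, mul_zero, div_zero]
  rw [commSymbol, sub_self, hmult, hmult, zero_div, zero_div, sub_zero]

lemma mult_sub_div (p : ℝ → ℝ) (h : ξ ≠ 0) (η : ℝ) :
    mult p (ξ - η) η / ξ = (2 * resonance p (ξ - η) η)⁻¹ := by
  simpa using mult_div_add p (a := ξ - η) (b := η) (by simpa)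

lemma abs_commSymbol_eq (hξ : ξ ≠ 0) (hsum : ξ - η + σ ≠ 0)
    (hD : resonance p (ξ - η) η * resonance p (ξ - η) σ ≠ 0) :
    |commSymbol p ξ η σ| = |resonance p (ξ - η) σ - resonance p (ξ - η) η| /
      (2 * |resonance p (ξ - η) η * resonance p (ξ - η) σ|) := by
  obtain ⟨hD₁, hD₂⟩ := mul_ne_zero_iff.1 hD
  rw [commSymbol, mult_sub_div p hξ, mult_div_add p hsum, ← abs_two, ← abs_mul, ← abs_div]
  congr 1
  rw [abs_two]
  field

lemma exists_abs_commSymbol_le (hα : -1 ≤ α) (hp : ContDiff ℝ 2 p) (heven : ∀ x, p (-x) = p x)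
    (hmono : StrictMonoOn p (Ici 0) ∨ StrictAntiOn p (Ici 0))
    (hderiv : deriv p =Θ[atTop] fun x => x ^ (α - 1))
    (hderiv₂ : iteratedDeriv 2 p =O[atTop] fun x => x ^ (α - 2)) :
    ∃ C : ℝ, ∀ ξ η σ : ℝ, (ξ, η, σ) ∈ nearDiagonal →
      |commSymbol p ξ η σ| ≤
        C * (|mult p (ξ - η) η / ξ| * |mult p (ξ - η) σ / (ξ - η + σ)|) *
          (|ξ - η| * |σ - η| * η ^ (α - 1)) := by
  obtain ⟨c, -, hlower⟩ := exists_sq_mul_rpow_le_abs_resonance_mul hα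
    (hp.differentiable two_ne_zero) heven hmono hderiv.2
  obtain ⟨K, -, hupper⟩ := exists_abs_resonance_sub_le hp hderiv.1 hderiv₂
  refine ⟨2 * K, fun ξ η σ hz => ?_⟩
  rcases eq_or_ne ξ η with rfl | hne
  · simp [commSymbol_self]
  have hD := (hlower ξ η σ hne hz).1
  obtain ⟨ha, hσ⟩ := abs_sub_le_of_mem_nearDiagonal hz
  obtain ⟨hξ, hη, -, hsum, -⟩ := hz
  have hξ0 : ξ ≠ 0 := by linarith
  have hsum0 : ξ - η + σ ≠ 0 := by linarith
  rw [abs_commSymbol_eq hξ0 hsum0 hD, mult_sub_div p hξ0, mult_div_add p hsum0]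
  calc |resonance p (ξ - η) σ - resonance p (ξ - η) η| /
        (2 * |resonance p (ξ - η) η * resonance p (ξ - η) σ|)
      ≤ K * (|ξ - η| * |σ - η| * η ^ (α - 1)) /
        (2 * |resonance p (ξ - η) η * resonance p (ξ - η) σ|) := by
        gcongr
        exact hupper _ _ _ hη ha hσ
    _ = 2 * K * (|(2 * resonance p (ξ - η) η)⁻¹| * |(2 * resonance p (ξ - η) σ)⁻¹|) *
        (|ξ - η| * |σ - η| * η ^ (α - 1)) := by
        simp only [abs_inv, abs_mul, abs_two]
        ring

lemma exists_abs_resonance_sub_mul_le (hp : ContDiff ℝ 2 p)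
    (hderiv : deriv p =O[atTop] fun x => x ^ (α - 1))
    (hderiv₂ : iteratedDeriv 2 p =O[atTop] fun x => x ^ (α - 2)) :
    ∃ K > 0, ∀ ξ η σ : ℝ, (ξ, η, σ) ∈ nearDiagonal →
      |resonance p (ξ - η) σ - resonance p (ξ - η) η| * |ξ - η| * ξ ≤
        K * (|η - σ| * ((ξ - η) ^ 2 * η ^ α)) := by
  obtain ⟨K, hK, hupper⟩ := exists_abs_resonance_sub_le hp hderiv hderiv₂
  refine ⟨2 * K, by positivity, fun ξ η σ hz => ?_⟩
  obtain ⟨ha, hσ⟩ := abs_sub_le_of_mem_nearDiagonal hz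
  obtain ⟨hξ, hη, -⟩ := hz
  have hη0 : 0 < η := by linarith
  calc |resonance p (ξ - η) σ - resonance p (ξ - η) η| * |ξ - η| * ξ
      ≤ K * (|ξ - η| * |σ - η| * η ^ (α - 1)) * |ξ - η| * (2 * η) := by
        gcongr
        · exact hupper _ _ _ hη ha hσ
        · linarith [le_abs_self (ξ - η)]
    _ = 2 * K * (|η - σ| * ((ξ - η) ^ 2 * η ^ α)) := by
        rw [Real.rpow_sub_one hη0.ne', abs_sub_comm σ, ← sq_abs (ξ - η)]
        field

lemma abs_le_sqrt_one_add_sq (x : ℝ) : |x| ≤ √(1 + x ^ 2) :=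
  Real.abs_le_sqrt (le_add_of_nonneg_left zero_le_one)

lemma exists_abs_commSymbol_mul_le (hα : -1 ≤ α) (hp : ContDiff ℝ 2 p) (heven : ∀ x, p (-x) = p x)
    (hmono : StrictMonoOn p (Ici 0) ∨ StrictAntiOn p (Ici 0))
    (hderiv : deriv p =Θ[atTop] fun x => x ^ (α - 1))
    (hderiv₂ : iteratedDeriv 2 p =O[atTop] fun x => x ^ (α - 2)) :
    ∃ C > 0, ∀ ξ η σ : ℝ, (ξ, η, σ) ∈ nearDiagonal →
      |commSymbol p ξ η σ| * |ξ - η| * ξ ≤ C * (√(1 + (ξ - η) ^ 2) * √(1 + (η - σ) ^ 2)) := by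
  obtain ⟨c, hc, hlower⟩ := exists_sq_mul_rpow_le_abs_resonance_mul hα
    (hp.differentiable two_ne_zero) heven hmono hderiv.2
  obtain ⟨K, hK, hupper⟩ := exists_abs_resonance_sub_mul_le hp hderiv.1 hderiv₂
  refine ⟨K / c, by positivity, fun ξ η σ hz => ?_⟩
  rcases eq_or_ne ξ η with rfl | hne
  · simp only [commSymbol_self, abs_zero, zero_mul]
    positivity
  obtain ⟨hD, hprod⟩ := hlower ξ η σ hne hz
  have hnum := hupper ξ η σ hz
  obtain ⟨hξ, hη, -, hsum, -⟩ := hz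
  have : 0 < η := by linarith
  have hbracket : 1 + |ξ - η| ≤ 2 * √(1 + (ξ - η) ^ 2) := by
    linarith [abs_le_sqrt_one_add_sq (ξ - η),
      Real.one_le_sqrt.2 (le_add_of_nonneg_right (sq_nonneg (ξ - η)))]
  have hlow := hprod.trans (mul_le_mul_of_nonneg_right hbracket (abs_nonneg _))
  have hησ := abs_le_sqrt_one_add_sq (η - σ)
  rw [abs_commSymbol_eq (by linarith) (by linarith) hD, div_mul_eq_mul_div, div_mul_eq_mul_div,
    div_le_iff₀ (by positivity)]
  calc |resonance p (ξ - η) σ - resonance p (ξ - η) η| * |ξ - η| * ξ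
      ≤ K * (|η - σ| * ((ξ - η) ^ 2 * η ^ α)) := hnum
    _ = K / c * |η - σ| * (c * ((ξ - η) ^ 2 * η ^ α)) := by field
    _ ≤ K / c * √(1 + (η - σ) ^ 2) * (2 * √(1 + (ξ - η) ^ 2) *
        |resonance p (ξ - η) η * resonance p (ξ - η) σ|) := by
        gcongr
    _ = K / c * (√(1 + (ξ - η) ^ 2) * √(1 + (η - σ) ^ 2)) *
        (2 * |resonance p (ξ - η) η * resonance p (ξ - η) σ|) := by ring

end Symbol

section LIntegral

variable {X : Type*} [MeasurableSpace X] {μ : Measure X}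

lemma sq_lintegral_le_lintegral_mul_lintegral {f φ : X → ℝ≥0∞} (hf : Measurable f)
    (hφ : Measurable φ) (hφ0 : ∀ x, φ x ≠ 0) (hφt : ∀ x, φ x ≠ ⊤) :
    (∫⁻ x, f x ∂μ) ^ 2 ≤ (∫⁻ x, φ x ∂μ) * ∫⁻ x, (φ x)⁻¹ * f x ^ 2 ∂μ := by
  have hsplit (x : X) : f x = φ x ^ (1 / 2 : ℝ) * ((φ x)⁻¹ ^ (1 / 2 : ℝ) * f x) := by
    rw [← mul_assoc, ← ENNReal.mul_rpow_of_nonneg _ _ (by norm_num),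
      ENNReal.mul_inv_cancel (hφ0 x) (hφt x), ENNReal.one_rpow, one_mul]
  have hsq (y : ℝ≥0∞) : (y ^ (1 / 2 : ℝ)) ^ 2 = y := by
    rw [← ENNReal.rpow_mul_natCast]
    norm_num
  have hholder := ENNReal.lintegral_mul_le_Lp_mul_Lq μ Real.HolderConjugate.two_two
    (f := fun x => φ x ^ (1 / 2 : ℝ)) (g := fun x => (φ x)⁻¹ ^ (1 / 2 : ℝ) * f x)
    (by fun_prop) (by fun_prop)
  simp only [Pi.mul_apply, ← hsplit, ENNReal.rpow_two, mul_pow, hsq] at hholder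
  calc (∫⁻ x, f x ∂μ) ^ 2 ≤ _ := pow_le_pow_left' hholder 2
    _ = _ := by rw [mul_pow, hsq, hsq]

lemma sq_lintegral_le_of_scale {f : ℝ → ℝ≥0∞} (hf : Measurable f) {γ : ℝ≥0} (hγ : γ ≠ 0) :
    (∫⁻ x, f x) ^ 2 ≤ ENNReal.ofReal (Real.pi / γ) * (∫⁻ x, ENNReal.ofReal (x ^ 2) * f x ^ 2) +
      ENNReal.ofReal (Real.pi * γ) * ∫⁻ x, f x ^ 2 := by
  have : 0 < (γ : ℝ) := NNReal.coe_pos.2 (pos_iff_ne_zero.2 hγ)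
  have hdens (x : ℝ) : (ProbabilityTheory.cauchyPDF 0 γ x)⁻¹ * f x ^ 2 =
      ENNReal.ofReal (Real.pi / γ) * (ENNReal.ofReal (x ^ 2) * f x ^ 2) +
        ENNReal.ofReal (Real.pi * γ) * f x ^ 2 := by
    rw [ProbabilityTheory.cauchyPDF, ← ENNReal.ofReal_inv_of_pos
      (ProbabilityTheory.cauchyPDF_pos 0 hγ x), ← mul_assoc, ← add_mul,
      ← ENNReal.ofReal_mul (by positivity), ← ENNReal.ofReal_add (by positivity) (by positivity),
      ProbabilityTheory.cauchyPDFReal_def]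
    congr 2
    field
  calc (∫⁻ x, f x) ^ 2
      ≤ (∫⁻ x, ProbabilityTheory.cauchyPDF 0 γ x) *
        ∫⁻ x, (ProbabilityTheory.cauchyPDF 0 γ x)⁻¹ * f x ^ 2 :=
        sq_lintegral_le_lintegral_mul_lintegral hf (ProbabilityTheory.measurable_cauchyPDF 0 γ)
          (fun x => (ENNReal.ofReal_pos.2 (ProbabilityTheory.cauchyPDF_pos 0 hγ x)).ne')
          fun _ => ENNReal.ofReal_ne_top
    _ = _ := by
        rw [ProbabilityTheory.lintegral_cauchyPDF_eq_one 0 hγ, one_mul, lintegral_congr hdens,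
          lintegral_add_left (by fun_prop), lintegral_const_mul _ (by fun_prop),
          lintegral_const_mul _ (by fun_prop)]

lemma le_two_mul_rpow_half_of_forall_scale {c : ℝ} (hc : 0 < c) {A B I : ℝ≥0∞} (hA0 : A ≠ 0)
    (hB0 : B ≠ 0)
    (hscale : ∀ γ : ℝ≥0, γ ≠ 0 → I ≤ ENNReal.ofReal (c / γ) * B + ENNReal.ofReal (c * γ) * A) :
    I ≤ ENNReal.ofReal (2 * c) * (A * B) ^ (1 / 2 : ℝ) := by
  have htop : ENNReal.ofReal (2 * c) * ⊤ ^ (1 / 2 : ℝ) = ⊤ := by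
    rw [ENNReal.top_rpow_of_pos (by norm_num), ENNReal.mul_top]
    simpa using hc
  rcases eq_or_ne A ⊤ with rfl | hA
  · rw [ENNReal.top_mul hB0, htop]
    exact le_top
  rcases eq_or_ne B ⊤ with rfl | hB
  · rw [ENNReal.mul_top hA0, htop]
    exact le_top
  lift A to ℝ≥0 using hA
  lift B to ℝ≥0 using hB
  obtain ⟨a, rfl⟩ : ∃ a, a ^ 2 = A := ⟨NNReal.sqrt A, NNReal.sq_sqrt A⟩
  obtain ⟨b, rfl⟩ : ∃ b, b ^ 2 = B := ⟨NNReal.sqrt B, NNReal.sq_sqrt B⟩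
  have ha : a ≠ 0 := by simpa using hA0
  have hb : b ≠ 0 := by simpa using hB0
  have hroot : (((a ^ 2 : ℝ≥0) : ℝ≥0∞) * (b ^ 2 : ℝ≥0)) ^ (1 / 2 : ℝ) = (a * b : ℝ≥0) := by
    rw [← ENNReal.coe_mul, ← mul_pow, ENNReal.coe_pow, ← ENNReal.rpow_natCast_mul]
    norm_num
  have hbalance : c / (b / a : ℝ≥0) * ↑(b ^ 2) + c * (b / a : ℝ≥0) * ↑(a ^ 2) =
      2 * c * (a * b : ℝ≥0) := by
    push_cast
    field
  refine (hscale (b / a) (div_ne_zero hb ha)).trans_eq ?_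
  rw [hroot, ← ENNReal.ofReal_coe_nnreal, ← ENNReal.ofReal_coe_nnreal, ← ENNReal.ofReal_coe_nnreal,
    ← ENNReal.ofReal_mul (by positivity), ← ENNReal.ofReal_mul (by positivity),
    ← ENNReal.ofReal_mul (by positivity), ← ENNReal.ofReal_add (by positivity) (by positivity),
    hbalance]

lemma carlson_inequality {f : ℝ → ℝ≥0∞} (hf : Measurable f) :
    (∫⁻ x, f x) ^ 2 ≤ ENNReal.ofReal (2 * Real.pi) *
      ((∫⁻ x, f x ^ 2) * ∫⁻ x, ENNReal.ofReal (x ^ 2) * f x ^ 2) ^ (1 / 2 : ℝ) := by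
  by_cases hzero : f =ᵐ[volume] 0
  · simp [lintegral_congr_ae hzero]
  refine le_two_mul_rpow_half_of_forall_scale Real.pi_pos ?_ ?_
    fun γ hγ => sq_lintegral_le_of_scale hf hγ
  · rw [Ne, lintegral_eq_zero_iff (by fun_prop)]
    exact fun h => hzero (h.mono fun x hx => by simpa using hx)
  · rw [Ne, lintegral_eq_zero_iff (by fun_prop)]
    refine fun h => hzero ?_
    filter_upwards [h, Measure.ae_ne volume 0] with x hx hx0
    have : ¬ x ^ 2 ≤ 0 := (by positivity : 0 < x ^ 2).not_ge
    simpa [this] using hx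

variable {G : Type*} [AddCommGroup G] [MeasurableSpace G] [MeasurableAdd₂ G] [MeasurableNeg G]
  {ν : Measure G} [SFinite ν] [ν.IsAddLeftInvariant]

lemma lintegral_mul_sub_mul_sub_left [ν.IsNegInvariant] {f g h : G → ℝ≥0∞} (hf : Measurable f)
    (hg : Measurable g) (hh : Measurable h) :
    ∫⁻ z : G × G × G, f (z.1 - z.2.1) * g (z.2.1 - z.2.2) * h z.1 ∂(ν.prod (ν.prod ν)) =
      (∫⁻ x, f x ∂ν) * (∫⁻ x, g x ∂ν) * ∫⁻ x, h x ∂ν := by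
  have hinner (ξ : G) : ∫⁻ w : G × G, f (ξ - w.1) * g (w.1 - w.2) * h ξ ∂(ν.prod ν) =
      (∫⁻ x, f x ∂ν) * (∫⁻ x, g x ∂ν) * h ξ := by
    rw [lintegral_mul_const _ (by fun_prop), lintegral_prod _ (by fun_prop)]
    have hη (η : G) : ∫⁻ σ, f (ξ - η) * g (η - σ) ∂ν = f (ξ - η) * ∫⁻ x, g x ∂ν := by
      rw [lintegral_const_mul _ (by fun_prop), lintegral_sub_left_eq_self]
    simp_rw [hη]
    rw [lintegral_mul_const _ (by fun_prop), lintegral_sub_left_eq_self]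
  rw [lintegral_prod _ (by fun_prop)]
  simp_rw [hinner]
  exact lintegral_const_mul _ hh

lemma lintegral_mul_sub_mul_sub_right {f g h : G → ℝ≥0∞} (hf : Measurable f)
    (hg : Measurable g) (hh : Measurable h) :
    ∫⁻ z : G × G × G, f (z.1 - z.2.1) * g (z.2.1 - z.2.2) * h z.2.2 ∂(ν.prod (ν.prod ν)) =
      (∫⁻ x, f x ∂ν) * (∫⁻ x, g x ∂ν) * ∫⁻ x, h x ∂ν := by
  have hξ (w : G × G) : ∫⁻ ξ, f (ξ - w.1) * g (w.1 - w.2) * h w.2 ∂ν =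
      (∫⁻ x, f x ∂ν) * (g (w.1 - w.2) * h w.2) := by
    simp_rw [mul_assoc]
    rw [lintegral_mul_const _ (by fun_prop), lintegral_sub_right_eq_self]
  have hη (σ : G) : ∫⁻ η, g (η - σ) * h σ ∂ν = (∫⁻ x, g x ∂ν) * h σ := by
    rw [lintegral_mul_const _ (by fun_prop), lintegral_sub_right_eq_self]
  rw [lintegral_prod_symm' _ (by fun_prop)]
  simp_rw [hξ]
  rw [lintegral_const_mul _ (by fun_prop), lintegral_prod_symm' _ (by fun_prop)]
  simp_rw [hη]
  rw [lintegral_const_mul _ hh, mul_assoc]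

lemma lintegral_mul_sub_mul_sub_mul_mul_le [ν.IsNegInvariant] {f g h : G → ℝ≥0∞}
    (hf : Measurable f) (hg : Measurable g) (hh : Measurable h) :
    ∫⁻ z : G × G × G, f (z.1 - z.2.1) * g (z.2.1 - z.2.2) * (h z.2.2 * h z.1)
        ∂(ν.prod (ν.prod ν)) ≤
      (∫⁻ x, f x ∂ν) * (∫⁻ x, g x ∂ν) * ∫⁻ x, h x ^ 2 ∂ν := by
  have hyoung (x y : ℝ≥0∞) : x * y ≤ x ^ 2 / 2 + y ^ 2 / 2 := by
    simpa using ENNReal.young_inequality x y Real.HolderConjugate.two_two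
  calc ∫⁻ z : G × G × G, f (z.1 - z.2.1) * g (z.2.1 - z.2.2) * (h z.2.2 * h z.1)
        ∂(ν.prod (ν.prod ν))
      ≤ ∫⁻ z : G × G × G, f (z.1 - z.2.1) * g (z.2.1 - z.2.2) * (h z.2.2 ^ 2 / 2) +
          f (z.1 - z.2.1) * g (z.2.1 - z.2.2) * (h z.1 ^ 2 / 2) ∂(ν.prod (ν.prod ν)) :=
        lintegral_mono fun z => (mul_le_mul_right (hyoung _ _) _).trans_eq (mul_add _ _ _)
    _ = (∫⁻ x, f x ∂ν) * (∫⁻ x, g x ∂ν) * ∫⁻ x, h x ^ 2 / 2 ∂ν +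
          (∫⁻ x, f x ∂ν) * (∫⁻ x, g x ∂ν) * ∫⁻ x, h x ^ 2 / 2 ∂ν := by
        rw [lintegral_add_left (by fun_prop),
          lintegral_mul_sub_mul_sub_right hf hg (h := fun x => h x ^ 2 / 2) (by fun_prop),
          lintegral_mul_sub_mul_sub_left hf hg (h := fun x => h x ^ 2 / 2) (by fun_prop)]
    _ = (∫⁻ x, f x ∂ν) * (∫⁻ x, g x ∂ν) * ∫⁻ x, h x ^ 2 ∂ν := by
        rw [← mul_add, ← lintegral_add_left (by fun_prop)]
        simp_rw [ENNReal.add_halves]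

end LIntegral

section Commutator

variable {p : ℝ → ℝ} {C : ℝ} {s k : ℕ} {u : Lp ℝ 2 (volume : Measure ℝ)}

/-- The modulus `⟨x⟩^s |û(x)|` of the Fourier transform of `⟨D⟩^s u`, valued in `ℝ≥0∞` so that
products and integrals of such densities need no integrability. -/
noncomputable def besselDensity (s : ℕ) (u : Lp ℝ 2 (volume : Measure ℝ)) (x : ℝ) : ℝ≥0∞ :=
  ENNReal.ofReal (√(1 + x ^ 2) ^ s * ‖uhat u x‖)

lemma normH_nonneg (s : ℕ) (u : Lp ℝ 2 (volume : Measure ℝ)) : 0 ≤ normH s u :=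
  Real.sqrt_nonneg _

@[fun_prop]
lemma measurable_uhat (u : Lp ℝ 2 (volume : Measure ℝ)) : Measurable (uhat u) :=
  (Lp.stronglyMeasurable _).measurable.comp (by fun_prop)

@[fun_prop]
lemma measurable_besselDensity (s : ℕ) (u : Lp ℝ 2 (volume : Measure ℝ)) :
    Measurable (besselDensity s u) := by
  unfold besselDensity
  fun_prop

lemma besselDensity_sq (s : ℕ) (u : Lp ℝ 2 (volume : Measure ℝ)) (x : ℝ) :
    besselDensity s u x ^ 2 = ENNReal.ofReal ((1 + x ^ 2) ^ s * ‖uhat u x‖ ^ 2) := by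
  rw [besselDensity, ← ENNReal.ofReal_pow (by positivity), mul_pow, ← pow_mul, mul_comm s, pow_mul,
    Real.sq_sqrt (by positivity)]

lemma ofReal_sq_mul_besselDensity_sq_le (s : ℕ) (u : Lp ℝ 2 (volume : Measure ℝ)) (x : ℝ) :
    ENNReal.ofReal (x ^ 2) * besselDensity s u x ^ 2 ≤ besselDensity (s + 1) u x ^ 2 := by
  rw [besselDensity_sq, besselDensity_sq, ← ENNReal.ofReal_mul (by positivity), ← mul_assoc,
    pow_succ' (1 + x ^ 2)]
  gcongr
  linarith

lemma MemH.mono {t : ℕ} (hst : s ≤ t) (h : MemH t u) : MemH s u := by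
  refine Integrable.mono' h (by fun_prop) (Eventually.of_forall fun x => ?_)
  have : 1 ≤ 1 + x ^ 2 := by linarith [sq_nonneg x]
  rw [Real.norm_of_nonneg (by positivity)]
  gcongr

lemma MemH.lintegral_besselDensity_sq (h : MemH s u) :
    ∫⁻ x, besselDensity s u x ^ 2 = ENNReal.ofReal (2 * Real.pi * normH s u ^ 2) := by
  have hnonneg (x : ℝ) : 0 ≤ (1 + x ^ 2) ^ s * ‖uhat u x‖ ^ 2 := by positivity
  have hnorm : 2 * Real.pi * normH s u ^ 2 = ∫ x : ℝ, (1 + x ^ 2) ^ s * ‖uhat u x‖ ^ 2 := by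
    rw [normH, Real.sq_sqrt (mul_nonneg (by positivity) (integral_nonneg hnonneg))]
    field
  simp_rw [besselDensity_sq]
  rw [hnorm, ofReal_integral_eq_lintegral_ofReal h (Eventually.of_forall hnonneg)]

lemma MemH.sq_lintegral_besselDensity_le (h : MemH (s + 1) u) :
    (∫⁻ x, besselDensity s u x) ^ 2 ≤
      ENNReal.ofReal ((2 * Real.pi) ^ 2 * (normH s u * normH (s + 1) u)) := by
  have hroot : ENNReal.ofReal (2 * Real.pi * normH s u ^ 2) *
      ENNReal.ofReal (2 * Real.pi * normH (s + 1) u ^ 2) =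
        ENNReal.ofReal (2 * Real.pi * (normH s u * normH (s + 1) u)) ^ 2 := by
    have : 0 ≤ normH s u * normH (s + 1) u := mul_nonneg (normH_nonneg _ _) (normH_nonneg _ _)
    rw [← ENNReal.ofReal_mul (by positivity), ← ENNReal.ofReal_pow (by positivity)]
    ring_nf
  calc (∫⁻ x, besselDensity s u x) ^ 2
      ≤ ENNReal.ofReal (2 * Real.pi) * ((∫⁻ x, besselDensity s u x ^ 2) *
          ∫⁻ x, ENNReal.ofReal (x ^ 2) * besselDensity s u x ^ 2) ^ (1 / 2 : ℝ) :=
        carlson_inequality (measurable_besselDensity s u)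
    _ ≤ ENNReal.ofReal (2 * Real.pi) * ((∫⁻ x, besselDensity s u x ^ 2) *
          ∫⁻ x, besselDensity (s + 1) u x ^ 2) ^ (1 / 2 : ℝ) := by
        have := lintegral_mono (μ := volume) (ofReal_sq_mul_besselDensity_sq_le s u)
        gcongr
    _ = ENNReal.ofReal (2 * Real.pi) *
          ENNReal.ofReal (2 * Real.pi * (normH s u * normH (s + 1) u)) := by
        rw [(h.mono s.le_succ).lintegral_besselDensity_sq, h.lintegral_besselDensity_sq, hroot,
          ← ENNReal.rpow_natCast_mul]
        norm_num
    _ = ENNReal.ofReal ((2 * Real.pi) ^ 2 * (normH s u * normH (s + 1) u)) := by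
        rw [← ENNReal.ofReal_mul (by positivity), ← mul_assoc, sq]

lemma measurable_commIntegrand (hp : Measurable p) (k : ℕ)
    (u : Lp ℝ 2 (volume : Measure ℝ)) : Measurable (commIntegrand p k u) := by
  have : Measurable (starRingEnd ℂ) := Complex.continuous_conj.measurable
  unfold commIntegrand quarticDensity commSymbol mult
  fun_prop

lemma norm_commIntegrand (p : ℝ → ℝ) (k : ℕ) (u : Lp ℝ 2 (volume : Measure ℝ)) (ξ η σ : ℝ) :
    ‖commIntegrand p k u (ξ, η, σ)‖ = |commSymbol p ξ η σ| * |ξ - η| * |ξ| *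
      (‖uhat u (ξ - η)‖ * ‖uhat u (η - σ)‖ * (|σ| ^ k * ‖uhat u σ‖) * (|ξ| ^ k * ‖uhat u ξ‖)) := by
  simp only [commIntegrand, quarticDensity, norm_mul, Complex.norm_real, norm_neg, norm_pow,
    Real.norm_eq_abs, RCLike.norm_conj]
  ring

lemma enorm_commIntegrand_le (hC : 0 ≤ C)
    (hsymbol : ∀ ξ η σ : ℝ, (ξ, η, σ) ∈ nearDiagonal →
      |commSymbol p ξ η σ| * |ξ - η| * ξ ≤ C * (√(1 + (ξ - η) ^ 2) * √(1 + (η - σ) ^ 2)))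
    (k : ℕ) (u : Lp ℝ 2 (volume : Measure ℝ)) {z : ℝ × ℝ × ℝ} (hz : z ∈ nearDiagonal) :
    ‖commIntegrand p k u z‖ₑ ≤ ENNReal.ofReal C * (besselDensity 1 u (z.1 - z.2.1) *
      besselDensity 1 u (z.2.1 - z.2.2) * (besselDensity k u z.2.2 * besselDensity k u z.1)) := by
  obtain ⟨ξ, η, σ⟩ := z
  have hξ : 0 < ξ := by linarith [hz.1]
  simp only [besselDensity, pow_one]
  rw [← ENNReal.ofReal_mul (by positivity), ← ENNReal.ofReal_mul (by positivity),
    ← ENNReal.ofReal_mul (by positivity), ← ENNReal.ofReal_mul hC, ← ofReal_norm,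
    norm_commIntegrand]
  nth_rewrite 1 [abs_of_pos hξ]
  refine ENNReal.ofReal_le_ofReal ?_
  calc |commSymbol p ξ η σ| * |ξ - η| * ξ *
        (‖uhat u (ξ - η)‖ * ‖uhat u (η - σ)‖ * (|σ| ^ k * ‖uhat u σ‖) * (|ξ| ^ k * ‖uhat u ξ‖))
      ≤ C * (√(1 + (ξ - η) ^ 2) * √(1 + (η - σ) ^ 2)) *
        (‖uhat u (ξ - η)‖ * ‖uhat u (η - σ)‖ * (√(1 + σ ^ 2) ^ k * ‖uhat u σ‖) *
          (√(1 + ξ ^ 2) ^ k * ‖uhat u ξ‖)) := by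
        have := abs_le_sqrt_one_add_sq σ
        have := abs_le_sqrt_one_add_sq ξ
        refine mul_le_mul (hsymbol ξ η σ hz) ?_ (by positivity) (by positivity)
        gcongr
    _ = _ := by ring

lemma setLIntegral_enorm_commIntegrand_le (hC : 0 ≤ C)
    (hsymbol : ∀ ξ η σ : ℝ, (ξ, η, σ) ∈ nearDiagonal →
      |commSymbol p ξ η σ| * |ξ - η| * ξ ≤ C * (√(1 + (ξ - η) ^ 2) * √(1 + (η - σ) ^ 2)))
    (hu2 : MemH 2 u) (huk : MemH k u) :
    ∫⁻ z in regA2cPos ∩ regB, ‖commIntegrand p k u z‖ₑ ≤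
      ENNReal.ofReal (C * (2 * Real.pi) ^ 3 * (normH 1 u * normH 2 u * normH k u ^ 2)) := by
  have : 0 ≤ normH 1 u * normH 2 u := mul_nonneg (normH_nonneg _ _) (normH_nonneg _ _)
  calc ∫⁻ z in regA2cPos ∩ regB, ‖commIntegrand p k u z‖ₑ
      ≤ ∫⁻ z in regA2cPos ∩ regB, ENNReal.ofReal C * (besselDensity 1 u (z.1 - z.2.1) *
          besselDensity 1 u (z.2.1 - z.2.2) *
            (besselDensity k u z.2.2 * besselDensity k u z.1)) :=
        setLIntegral_mono (by fun_prop) fun z hz =>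
          enorm_commIntegrand_le hC hsymbol k u (regA2cPos_inter_regB_subset hz)
    _ ≤ ∫⁻ z : ℝ × ℝ × ℝ, ENNReal.ofReal C * (besselDensity 1 u (z.1 - z.2.1) *
          besselDensity 1 u (z.2.1 - z.2.2) *
            (besselDensity k u z.2.2 * besselDensity k u z.1)) := setLIntegral_le_lintegral _ _
    _ ≤ ENNReal.ofReal C * ((∫⁻ x, besselDensity 1 u x) * (∫⁻ x, besselDensity 1 u x) *
          ∫⁻ x, besselDensity k u x ^ 2) := by
        rw [lintegral_const_mul _ (by fun_prop)]
        gcongr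
        exact lintegral_mul_sub_mul_sub_mul_mul_le (measurable_besselDensity 1 u)
          (measurable_besselDensity 1 u) (measurable_besselDensity k u)
    _ ≤ ENNReal.ofReal C * (ENNReal.ofReal ((2 * Real.pi) ^ 2 * (normH 1 u * normH 2 u)) *
          ENNReal.ofReal (2 * Real.pi * normH k u ^ 2)) := by
        rw [← sq, huk.lintegral_besselDensity_sq]
        gcongr
        exact hu2.sq_lintegral_besselDensity_le
    _ = ENNReal.ofReal (C * (2 * Real.pi) ^ 3 * (normH 1 u * normH 2 u * normH k u ^ 2)) := by
        rw [← ENNReal.ofReal_mul (by positivity), ← ENNReal.ofReal_mul hC]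
        ring_nf

lemma integrableOn_commIntegrand_and_norm_mainCommutator_le (hp : Measurable p) (hC : 0 ≤ C)
    (hsymbol : ∀ ξ η σ : ℝ, (ξ, η, σ) ∈ nearDiagonal →
      |commSymbol p ξ η σ| * |ξ - η| * ξ ≤ C * (√(1 + (ξ - η) ^ 2) * √(1 + (η - σ) ^ 2)))
    (hu2 : MemH 2 u) (huk : MemH k u) :
    IntegrableOn (commIntegrand p k u) (regA2cPos ∩ regB) ∧
      ‖mainCommutator p k u‖ ≤
        C * (2 * Real.pi) ^ 3 * (normH 1 u * normH 2 u * normH k u ^ 2) := by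
  have hbound := setLIntegral_enorm_commIntegrand_le hC hsymbol hu2 huk
  have : 0 ≤ normH 1 u * normH 2 u := mul_nonneg (normH_nonneg _ _) (normH_nonneg _ _)
  refine ⟨⟨(measurable_commIntegrand hp k u).aestronglyMeasurable,
    hbound.trans_lt ENNReal.ofReal_lt_top⟩, ?_⟩
  rw [mainCommutator, norm_mul, Complex.norm_I, one_mul, ← toReal_enorm]
  exact ENNReal.toReal_le_of_le_ofReal (by positivity)
    ((enorm_integral_le_lintegral_enorm _).trans hbound)

end Commutator

end Whitham

theorem mainTheorem6_general {α : ℝ} {p : ℝ → ℝ} (hα : -1 ≤ α) (hp : ContDiff ℝ 2 p)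
    (heven : ∀ ξ, p (-ξ) = p ξ)
    (hmono : StrictMonoOn p (Ici 0) ∨ StrictAntiOn p (Ici 0))
    (hderiv : deriv p =Θ[atTop] fun x => x ^ (α - 1))
    (hderiv₂ : iteratedDeriv 2 p =O[atTop] fun x => x ^ (α - 2)) :
    (∃ C : ℝ, ∀ ξ η σ : ℝ, (ξ, η, σ) ∈ Whitham.regA2cPos ∩ Whitham.regB →
      |Whitham.commSymbol p ξ η σ| ≤
        C * (|Whitham.mult p (ξ - η) η / ξ| * |Whitham.mult p (ξ - η) σ / (ξ - η + σ)|) *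
          (|ξ - η| * |σ - η| * η ^ (α - 1))) ∧
    ∃ C : ℝ, ∀ (k : ℕ) (u : Lp ℝ 2 (volume : Measure ℝ)), Whitham.MemH 2 u → Whitham.MemH k u →
      IntegrableOn (Whitham.commIntegrand p k u) (Whitham.regA2cPos ∩ Whitham.regB) ∧
        ‖Whitham.mainCommutator p k u‖ ≤
          C * (Whitham.normH 1 u * Whitham.normH 2 u * Whitham.normH k u ^ 2) := by
  constructor
  · obtain ⟨C, hC⟩ := Whitham.exists_abs_commSymbol_le hα hp heven hmono hderiv hderiv₂
    exact ⟨C, fun ξ η σ hz => hC ξ η σ (Whitham.regA2cPos_inter_regB_subset hz)⟩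
  · obtain ⟨C, hC, hsymbol⟩ :=
      Whitham.exists_abs_commSymbol_mul_le hα hp heven hmono hderiv hderiv₂
    exact ⟨C * (2 * Real.pi) ^ 3, fun k u hu2 huk =>
      Whitham.integrableOn_commIntegrand_and_norm_mainCommutator_le hp.continuous.measurable
        hC.le hsymbol hu2 huk⟩

theorem mainTheorem6 (α : ℝ) (j k : ℕ) (p : ℝ → ℝ) (hp : Whitham.IsSymbol α j p)
    (hk : 2 * j - 1 ≤ k) :
    (∃ C : ℝ, ∀ ξ η σ : ℝ, (ξ, η, σ) ∈ Whitham.regA2cPos ∩ Whitham.regB →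
      |Whitham.commSymbol p ξ η σ| ≤
        C * (|Whitham.mult p (ξ - η) η / ξ| * |Whitham.mult p (ξ - η) σ / (ξ - η + σ)|) *
          (|ξ - η| * |σ - η| * η ^ (α - 1))) ∧
    ∃ C : ℝ, ∀ u : MeasureTheory.Lp ℝ 2 (MeasureTheory.volume : MeasureTheory.Measure ℝ),
      Whitham.MemH 2 u → Whitham.MemH k u →
        MeasureTheory.IntegrableOn (Whitham.commIntegrand p k u)
          (Whitham.regA2cPos ∩ Whitham.regB) ∧
        ‖Whitham.mainCommutator p k u‖ ≤
          C * (Whitham.normH 1 u * Whitham.normH 2 u * Whitham.normH k u ^ 2) := by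
  have habs := Whitham.eventuallyEq_abs_rpow_atTop
  exact (mainTheorem6_general hp.order_mem.1 hp.contDiff hp.even hp.strictMonotone
    ((hp.far_one.mono atTop_le_cocompact).trans_eventuallyEq (habs _))
    ((hp.far_two.mono atTop_le_cocompact).trans_eventuallyEq (habs _))).imp_right
      fun ⟨C, hC⟩ => ⟨C, hC k⟩
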